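/- Let $VB_n$ be the virtual braid group, generated by $\sigma_1,\dots,\sigma_{n-1}$ and $\rho_1,\dots,\rho_{n-1}$ with defining relations $\sigma_i\sigma_{i+1}\sigma_i=\sigma_{i+1}\sigma_i\sigma_{i+1}$, $\rho_i\rho_{i+1}\rho_i=\rho_{i+1}\rho_i\rho_{i+1}$, $\rho_i\rho_{i+1}\sigma_i=\sigma_{i+1}\rho_i\rho_{i+1}$, $\rho_i^2=1$, and $\sigma_i\sigma_j=\sigma_j\sigma_i$, $\rho_i\rho_j=\rho_j\rho_i$, $\sigma_i\rho_j=\rho_j\sigma_i$ for $|i-j|\ge 2$. Let $\varphi_A$ be the representation of $VB_n$ by automorphisms (acting on the right) of the free group $F_{n+1}=\langle x_1,\dots,x_n,y\rangle$ in which $\sigma_i$ acts by $x_i\mapsto x_ix_{i+1}x_i^{-1}$, $x_{i+1}\mapsto x_i$, and $\rho_i$ acts by $x_i\mapsto yx_{i+1}y^{-1}$, $x_{i+1}\mapsto y^{-1}x_iy$, all other generators being fixed. For $\beta\in VB_n$ put $$G_A(\beta)=\langle x_1,\dots,x_n,y \mid h=\varphi_A(\beta)(h)\ \text{ for } h\in\{x_1,\dots,x_n,y\}\rangle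 .$$ The virtual trefoil $K_1$ is the closure of $\beta_1=\sigma_1^{-2}\rho_1\in VB_2$, and $G_A(K_1)=G_A(\beta_1)$. Write $[a,b]=a^{-1}b^{-1}ab$ and $[a,b,c,d]=[[[a,b],c],d]$. A nontrivial group $G$ is residually nilpotent if for every $1\ne g\in G$ there are a nilpotent group $N$ and a homomorphism $\varphi:G\to N$ with $\varphi(g)\neq 1$. **Corollary.** The closure of $\beta_1$ is a virtual knot (it has exactly one component), its group has the presentation $$G_A(K_1)\cong\langle x,y \mid [x^{-1},y,x^{-1},yx^{-1}]=1\rangle ,$$ and $G_A(K_1)$ is residually nilpotent. In particular, there is a virtual knot whose group is residually nilpotent. -/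

import Mathlib

set_option linter.unusedSimpArgs false

/-! ## Virtual braid groups -/

/-- Generators of the virtual braid group on `n` strands. The index `i : Fin (n - 1)` is zero-based:
`σ i` and `ρ i` are the classical and the virtual crossing of the strands `i` and `i + 1`. -/
inductive VBGen (n : ℕ) : Type
  | σ (i : Fin (n - 1)) : VBGen n
  | ρ (i : Fin (n - 1)) : VBGen n

/-- The word `σ_i`. -/
def VBGen.s {n : ℕ} (i : Fin (n - 1)) : FreeGroup (VBGen n) := FreeGroup.of (VBGen.σ i)

/-- The word `ρ_i`. -/
def VBGen.r {n : ℕ} (i : Fin (n - 1)) : FreeGroup (VBGen n) := FreeGroup.of (VBGen.ρ i)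

open VBGen in
/-- The defining relations of the virtual braid group on `n` strands; a relation `u = v` is
recorded as the relator `u * v⁻¹`. -/
inductive VBRel (n : ℕ) : FreeGroup (VBGen n) → Prop
  | braid (i j : Fin (n - 1)) (h : (j : ℕ) = i + 1) :
      VBRel n ((s i * s j * s i) * (s j * s i * s j)⁻¹)
  | comm (i j : Fin (n - 1)) (h : (i : ℕ) + 2 ≤ j ∨ (j : ℕ) + 2 ≤ i) :
      VBRel n ((s i * s j) * (s j * s i)⁻¹)
  | vsq (i : Fin (n - 1)) : VBRel n (r i * r i)
  | vbraid (i j : Fin (n - 1)) (h : (j : ℕ) = i + 1) :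
      VBRel n ((r i * r j * r i) * (r j * r i * r j)⁻¹)
  | vcomm (i j : Fin (n - 1)) (h : (i : ℕ) + 2 ≤ j ∨ (j : ℕ) + 2 ≤ i) :
      VBRel n ((r i * r j) * (r j * r i)⁻¹)
  | mcomm (i j : Fin (n - 1)) (h : (i : ℕ) + 2 ≤ j ∨ (j : ℕ) + 2 ≤ i) :
      VBRel n ((s i * r j) * (r j * s i)⁻¹)
  | mixed (i j : Fin (n - 1)) (h : (j : ℕ) = i + 1) :
      VBRel n ((r i * r j * s i) * (s j * r i * r j)⁻¹)

/-- The virtual braid group `VB_n`. -/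
abbrev VB (n : ℕ) : Type := PresentedGroup {w : FreeGroup (VBGen n) | VBRel n w}

/-- The element `σ_i` of `VB_n` (zero-based index). -/
def VB.σ {n : ℕ} (i : Fin (n - 1)) : VB n := PresentedGroup.of (VBGen.σ i)

/-- The element `ρ_i` of `VB_n` (zero-based index). -/
def VB.ρ {n : ℕ} (i : Fin (n - 1)) : VB n := PresentedGroup.of (VBGen.ρ i)

/-! ## The underlying permutation, and closures that are knots -/

/-- The left strand of a crossing. -/
def VB.lo {n : ℕ} (i : Fin (n - 1)) : Fin n := ⟨i, by omega⟩

/-- The right strand of a crossing. -/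
def VB.hi {n : ℕ} (i : Fin (n - 1)) : Fin n := ⟨i + 1, by omega⟩

/-- `σ_i` and `ρ_i` both permute the end points by the transposition `(i, i + 1)`. -/
def VB.genPerm {n : ℕ} : VBGen n → (Equiv.Perm (Fin n))ᵐᵒᵖ
  | .σ i => MulOpposite.op (Equiv.swap (VB.lo i) (VB.hi i))
  | .ρ i => MulOpposite.op (Equiv.swap (VB.lo i) (VB.hi i))

theorem VB.adj {n : ℕ} {i j : Fin (n - 1)} (h : (j : ℕ) = i + 1) :
    VB.hi i = VB.lo j ∧ VB.lo i ≠ VB.lo j ∧ VB.lo i ≠ VB.hi j ∧ VB.lo j ≠ VB.hi j ∧ VB.hi j ≠ VB.lo i ∧ VB.hi j ≠ VB.lo j := by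
  simp only [VB.lo, VB.hi, ne_eq, Fin.ext_iff]
  omega

theorem VB.far {n : ℕ} {i j : Fin (n - 1)} (h : (i : ℕ) + 2 ≤ j ∨ (j : ℕ) + 2 ≤ i) :
    VB.lo i ≠ VB.lo j ∧ VB.lo i ≠ VB.hi j ∧ VB.hi i ≠ VB.lo j ∧ VB.hi i ≠ VB.hi j ∧
    VB.lo j ≠ VB.lo i ∧ VB.lo j ≠ VB.hi i ∧ VB.hi j ≠ VB.lo i ∧ VB.hi j ≠ VB.hi i := by
  simp only [VB.lo, VB.hi, ne_eq, Fin.ext_iff]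
  omega

theorem VB.swap_braid {α : Type*} [DecidableEq α] (a b c : α) (hab : a ≠ b) (hac : a ≠ c)
    (hbc : b ≠ c) : Equiv.swap a b * Equiv.swap b c * Equiv.swap a b =
      Equiv.swap b c * Equiv.swap a b * Equiv.swap b c := by
  rw [Equiv.swap_mul_swap_mul_swap hab hac, Equiv.swap_comm a b, Equiv.swap_comm b c,
    Equiv.swap_mul_swap_mul_swap hbc.symm hac.symm, Equiv.swap_comm]

theorem VB.swap_comm_of_ne {α : Type*} [DecidableEq α] (a b c d : α) (hca : c ≠ a) (hcb : c ≠ b)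
    (hda : d ≠ a) (hdb : d ≠ b) :
    Equiv.swap c d * Equiv.swap a b = Equiv.swap a b * Equiv.swap c d := by
  rw [Equiv.mul_swap_eq_swap_mul, Equiv.swap_apply_of_ne_of_ne hca.symm hda.symm,
    Equiv.swap_apply_of_ne_of_ne hcb.symm hdb.symm]

theorem VB.genPerm_rel (n : ℕ) :
    ∀ w ∈ {w : FreeGroup (VBGen n) | VBRel n w}, FreeGroup.lift (VB.genPerm (n := n)) w = 1 := by
  rintro w hw
  cases hw with
  | vsq i =>
    simp only [map_mul, VBGen.r, FreeGroup.lift_apply_of]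
    apply MulOpposite.unop_injective
    simp [VB.genPerm]
  | braid i j h =>
    simp only [map_mul, map_inv, mul_inv_eq_one, VBGen.s, VBGen.r, FreeGroup.lift_apply_of]
    apply MulOpposite.unop_injective
    simp only [MulOpposite.unop_mul, VB.genPerm, MulOpposite.unop_op]
    obtain ⟨e, e1, e2, e3, e4, e5⟩ := VB.adj h
    rw [e, ← mul_assoc, ← mul_assoc]
    exact VB.swap_braid _ _ _ e1 e2 e3
  | vbraid i j h =>
    simp only [map_mul, map_inv, mul_inv_eq_one, VBGen.s, VBGen.r, FreeGroup.lift_apply_of]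
    apply MulOpposite.unop_injective
    simp only [MulOpposite.unop_mul, VB.genPerm, MulOpposite.unop_op]
    obtain ⟨e, e1, e2, e3, e4, e5⟩ := VB.adj h
    rw [e, ← mul_assoc, ← mul_assoc]
    exact VB.swap_braid _ _ _ e1 e2 e3
  | mixed i j h =>
    simp only [map_mul, map_inv, mul_inv_eq_one, VBGen.s, VBGen.r, FreeGroup.lift_apply_of]
    apply MulOpposite.unop_injective
    simp only [MulOpposite.unop_mul, VB.genPerm, MulOpposite.unop_op]
    obtain ⟨e, e1, e2, e3, e4, e5⟩ := VB.adj h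
    rw [e, ← mul_assoc, ← mul_assoc]
    exact VB.swap_braid _ _ _ e1 e2 e3
  | comm i j h =>
    simp only [map_mul, map_inv, mul_inv_eq_one, VBGen.s, VBGen.r, FreeGroup.lift_apply_of]
    apply MulOpposite.unop_injective
    simp only [MulOpposite.unop_mul, VB.genPerm, MulOpposite.unop_op]
    obtain ⟨e1, e2, e3, e4, e5, e6, e7, e8⟩ := VB.far h
    exact VB.swap_comm_of_ne _ _ _ _ e5 e6 e7 e8
  | vcomm i j h =>
    simp only [map_mul, map_inv, mul_inv_eq_one, VBGen.s, VBGen.r, FreeGroup.lift_apply_of]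
    apply MulOpposite.unop_injective
    simp only [MulOpposite.unop_mul, VB.genPerm, MulOpposite.unop_op]
    obtain ⟨e1, e2, e3, e4, e5, e6, e7, e8⟩ := VB.far h
    exact VB.swap_comm_of_ne _ _ _ _ e5 e6 e7 e8
  | mcomm i j h =>
    simp only [map_mul, map_inv, mul_inv_eq_one, VBGen.s, VBGen.r, FreeGroup.lift_apply_of]
    apply MulOpposite.unop_injective
    simp only [MulOpposite.unop_mul, VB.genPerm, MulOpposite.unop_op]
    obtain ⟨e1, e2, e3, e4, e5, e6, e7, e8⟩ := VB.far h
    exact VB.swap_comm_of_ne _ _ _ _ e5 e6 e7 e8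

/-- The permutation of the strands induced by a virtual braid (composed from left to right). -/
def VB.perm (n : ℕ) : VB n →* (Equiv.Perm (Fin n))ᵐᵒᵖ :=
  PresentedGroup.toGroup (VB.genPerm_rel n)

/-- The closure of a virtual braid is a (one-component) virtual knot: there is at least one strand
and the induced permutation has a single orbit on the strands. -/
def VB.ClosureIsKnot {n : ℕ} (β : VB n) : Prop :=
  0 < n ∧ ∀ j k : Fin n, (VB.perm n β).unop.SameCycle j k

/-! ## The representation `φ_A` of `VB_n` by automorphisms of `F_{n+1}` -/

/-- The basis `x_0, …, x_{n-1}, y` of the free group `F_{n+1}`. -/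
inductive FGen (n : ℕ) : Type
  | x (j : Fin n) : FGen n
  | y : FGen n

namespace PhiA

/-- The basis element `x_j`. -/
def X {n : ℕ} (j : Fin n) : FreeGroup (FGen n) := FreeGroup.of (FGen.x j)

/-- The basis element `y`. -/
def Y {n : ℕ} : FreeGroup (FGen n) := FreeGroup.of FGen.y

open VB (lo hi)

/-- `σ_i`: `x_i ↦ x_i x_{i+1} x_i⁻¹`, `x_{i+1} ↦ x_i`. -/
def sigmaHom {n : ℕ} (i : Fin (n - 1)) : FreeGroup (FGen n) →* FreeGroup (FGen n) :=
  FreeGroup.lift fun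
    | .x j => if (j : ℕ) = i then X (lo i) * X (hi i) * (X (lo i))⁻¹
        else if (j : ℕ) = i + 1 then X (lo i) else X j
    | .y => Y

/-- The inverse of `σ_i`: `x_i ↦ x_{i+1}`, `x_{i+1} ↦ x_{i+1}⁻¹ x_i x_{i+1}`. -/
def sigmaInvHom {n : ℕ} (i : Fin (n - 1)) : FreeGroup (FGen n) →* FreeGroup (FGen n) :=
  FreeGroup.lift fun
    | .x j => if (j : ℕ) = i then X (hi i)
        else if (j : ℕ) = i + 1 then (X (hi i))⁻¹ * X (lo i) * X (hi i) else X j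
    | .y => Y

/-- `ρ_i`: `x_i ↦ y x_{i+1} y⁻¹`, `x_{i+1} ↦ y⁻¹ x_i y`. -/
def rhoHom {n : ℕ} (i : Fin (n - 1)) : FreeGroup (FGen n) →* FreeGroup (FGen n) :=
  FreeGroup.lift fun
    | .x j => if (j : ℕ) = i then Y * X (hi i) * Y⁻¹
        else if (j : ℕ) = i + 1 then Y⁻¹ * X (lo i) * Y else X j
    | .y => Y

theorem lo_ne_hi {n : ℕ} (i : Fin (n - 1)) : lo i ≠ hi i := by
  simp [lo, hi, Fin.ext_iff]

theorem sigmaHom_lo {n : ℕ} (i : Fin (n - 1)) :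
    sigmaHom i (X (lo i)) = X (lo i) * X (hi i) * (X (lo i))⁻¹ := by
  simp [sigmaHom, X, lo]

theorem sigmaHom_hi {n : ℕ} (i : Fin (n - 1)) : sigmaHom i (X (hi i)) = X (lo i) := by
  simp [sigmaHom, X, hi]

theorem sigmaHom_ne {n : ℕ} (i : Fin (n - 1)) (k : Fin n) (h1 : k ≠ lo i) (h2 : k ≠ hi i) :
    sigmaHom i (X k) = X k := by
  have h1' : (k : ℕ) ≠ i := fun h => h1 (Fin.ext h)
  have h2' : (k : ℕ) ≠ i + 1 := fun h => h2 (Fin.ext h)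
  simp [sigmaHom, X, h1', h2']

theorem sigmaHom_Y {n : ℕ} (i : Fin (n - 1)) : sigmaHom i (Y : FreeGroup (FGen n)) = Y := by
  simp [sigmaHom, Y]

theorem sigmaInvHom_lo {n : ℕ} (i : Fin (n - 1)) : sigmaInvHom i (X (lo i)) = X (hi i) := by
  simp [sigmaInvHom, X, lo]

theorem sigmaInvHom_hi {n : ℕ} (i : Fin (n - 1)) :
    sigmaInvHom i (X (hi i)) = (X (hi i))⁻¹ * X (lo i) * X (hi i) := by
  simp [sigmaInvHom, X, hi]

theorem sigmaInvHom_ne {n : ℕ} (i : Fin (n - 1)) (k : Fin n) (h1 : k ≠ lo i) (h2 : k ≠ hi i) :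
    sigmaInvHom i (X k) = X k := by
  have h1' : (k : ℕ) ≠ i := fun h => h1 (Fin.ext h)
  have h2' : (k : ℕ) ≠ i + 1 := fun h => h2 (Fin.ext h)
  simp [sigmaInvHom, X, h1', h2']

theorem sigmaInvHom_Y {n : ℕ} (i : Fin (n - 1)) :
    sigmaInvHom i (Y : FreeGroup (FGen n)) = Y := by
  simp [sigmaInvHom, Y]

theorem rhoHom_lo {n : ℕ} (i : Fin (n - 1)) :
    rhoHom i (X (lo i)) = Y * X (hi i) * Y⁻¹ := by
  simp [rhoHom, X, lo]

theorem rhoHom_hi {n : ℕ} (i : Fin (n - 1)) :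
    rhoHom i (X (hi i)) = Y⁻¹ * X (lo i) * Y := by
  simp [rhoHom, X, hi]

theorem rhoHom_ne {n : ℕ} (i : Fin (n - 1)) (k : Fin n) (h1 : k ≠ lo i) (h2 : k ≠ hi i) :
    rhoHom i (X k) = X k := by
  have h1' : (k : ℕ) ≠ i := fun h => h1 (Fin.ext h)
  have h2' : (k : ℕ) ≠ i + 1 := fun h => h2 (Fin.ext h)
  simp [rhoHom, X, h1', h2']

theorem rhoHom_Y {n : ℕ} (i : Fin (n - 1)) : rhoHom i (Y : FreeGroup (FGen n)) = Y := by
  simp [rhoHom, Y]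

theorem hom_ext {n : ℕ} {f g : FreeGroup (FGen n) →* FreeGroup (FGen n)}
    (hx : ∀ j, f (X j) = g (X j)) (hy : f Y = g Y) : f = g := by
  apply FreeGroup.ext_hom
  rintro (j | _)
  · exact hx j
  · exact hy

theorem sigmaInvHom_sigmaHom {n : ℕ} (i : Fin (n - 1)) :
    (sigmaInvHom i).comp (sigmaHom i) = MonoidHom.id (FreeGroup (FGen n)) := by
  apply hom_ext
  · intro k
    by_cases h1 : k = lo i
    · subst h1; simp [sigmaHom_lo, sigmaHom_hi, sigmaHom_ne, sigmaHom_Y,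
      sigmaInvHom_lo, sigmaInvHom_hi, sigmaInvHom_ne, sigmaInvHom_Y, mul_assoc]
    by_cases h2 : k = hi i
    · subst h2; simp [sigmaHom_lo, sigmaHom_hi, sigmaHom_ne, sigmaHom_Y,
      sigmaInvHom_lo, sigmaInvHom_hi, sigmaInvHom_ne, sigmaInvHom_Y, mul_assoc]
    simp [sigmaHom_lo, sigmaHom_hi, sigmaHom_ne, sigmaHom_Y,
      sigmaInvHom_lo, sigmaInvHom_hi, sigmaInvHom_ne, sigmaInvHom_Y, h1, h2]
  · simp [sigmaHom_lo, sigmaHom_hi, sigmaHom_ne, sigmaHom_Y,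
      sigmaInvHom_lo, sigmaInvHom_hi, sigmaInvHom_ne, sigmaInvHom_Y]

theorem sigmaHom_sigmaInvHom {n : ℕ} (i : Fin (n - 1)) :
    (sigmaHom i).comp (sigmaInvHom i) = MonoidHom.id (FreeGroup (FGen n)) := by
  apply hom_ext
  · intro k
    by_cases h1 : k = lo i
    · subst h1; simp [sigmaHom_lo, sigmaHom_hi, sigmaHom_ne, sigmaHom_Y,
      sigmaInvHom_lo, sigmaInvHom_hi, sigmaInvHom_ne, sigmaInvHom_Y, mul_assoc]
    by_cases h2 : k = hi i
    · subst h2; simp [sigmaHom_lo, sigmaHom_hi, sigmaHom_ne, sigmaHom_Y,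
      sigmaInvHom_lo, sigmaInvHom_hi, sigmaInvHom_ne, sigmaInvHom_Y, mul_assoc]
    simp [sigmaHom_lo, sigmaHom_hi, sigmaHom_ne, sigmaHom_Y,
      sigmaInvHom_lo, sigmaInvHom_hi, sigmaInvHom_ne, sigmaInvHom_Y, h1, h2]
  · simp [sigmaHom_lo, sigmaHom_hi, sigmaHom_ne, sigmaHom_Y,
      sigmaInvHom_lo, sigmaInvHom_hi, sigmaInvHom_ne, sigmaInvHom_Y]

theorem rhoHom_rhoHom {n : ℕ} (i : Fin (n - 1)) :
    (rhoHom i).comp (rhoHom i) = MonoidHom.id (FreeGroup (FGen n)) := by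
  apply hom_ext
  · intro k
    by_cases h1 : k = lo i
    · subst h1; simp [rhoHom_lo, rhoHom_hi, rhoHom_ne, rhoHom_Y, mul_assoc]
    by_cases h2 : k = hi i
    · subst h2; simp [rhoHom_lo, rhoHom_hi, rhoHom_ne, rhoHom_Y, mul_assoc]
    simp [rhoHom_lo, rhoHom_hi, rhoHom_ne, rhoHom_Y, h1, h2]
  · simp [rhoHom_lo, rhoHom_hi, rhoHom_ne, rhoHom_Y]

/-- The automorphism `φ_A(σ_i)` of `F_{n+1}`. -/
def sigmaAut {n : ℕ} (i : Fin (n - 1)) : MulAut (FreeGroup (FGen n)) :=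
  MonoidHom.toMulEquiv (sigmaHom i) (sigmaInvHom i)
    (sigmaInvHom_sigmaHom i) (sigmaHom_sigmaInvHom i)

/-- The automorphism `φ_A(ρ_i)` of `F_{n+1}`. -/
def rhoAut {n : ℕ} (i : Fin (n - 1)) : MulAut (FreeGroup (FGen n)) :=
  MonoidHom.toMulEquiv (rhoHom i) (rhoHom i) (rhoHom_rhoHom i) (rhoHom_rhoHom i)

/-- `φ_A` on generators. Automorphisms act on the right, i.e. products are composed from left to
right, whence the opposite group. -/
def gen {n : ℕ} : VBGen n → (MulAut (FreeGroup (FGen n)))ᵐᵒᵖ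
  | .σ i => MulOpposite.op (sigmaAut i)
  | .ρ i => MulOpposite.op (rhoAut i)

theorem aut_ext {n : ℕ} {f g : MulAut (FreeGroup (FGen n))}
    (hx : ∀ j, f (X j) = g (X j)) (hy : f Y = g Y) : f = g := by
  have h : f.toMonoidHom = g.toMonoidHom := hom_ext hx hy
  ext w
  exact DFunLike.congr_fun h w

theorem sigmaAut_apply {n : ℕ} (i : Fin (n - 1)) (w : FreeGroup (FGen n)) :
    sigmaAut i w = sigmaHom i w := rfl

theorem rhoAut_apply {n : ℕ} (i : Fin (n - 1)) (w : FreeGroup (FGen n)) :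
    rhoAut i w = rhoHom i w := rfl

/-- Two automorphisms agree if they agree on four given basis elements and fix the others. -/
theorem aut_ext_four {n : ℕ} {f g : MulAut (FreeGroup (FGen n))} (a b c d : Fin n)
    (ha : f (X a) = g (X a)) (hb : f (X b) = g (X b)) (hc : f (X c) = g (X c))
    (hd : f (X d) = g (X d))
    (h : ∀ k, k ≠ a → k ≠ b → k ≠ c → k ≠ d → f (X k) = g (X k)) (hy : f Y = g Y) : f = g := by
  refine aut_ext (fun k => ?_) hy
  by_cases h1 : k = a
  · rwa [h1]
  by_cases h2 : k = b
  · rwa [h2]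
  by_cases h3 : k = c
  · rwa [h3]
  by_cases h4 : k = d
  · rwa [h4]
  exact h k h1 h2 h3 h4

theorem gen_rel (n : ℕ) :
    ∀ w ∈ {w : FreeGroup (VBGen n) | VBRel n w}, FreeGroup.lift (gen (n := n)) w = 1 := by
  rintro w hw
  cases hw with
  | vsq i =>
    simp only [map_mul, VBGen.r, FreeGroup.lift_apply_of]
    apply MulOpposite.unop_injective
    simp only [MulOpposite.unop_mul, MulOpposite.unop_one, gen, MulOpposite.unop_op]
    ext w
    exact DFunLike.congr_fun (rhoHom_rhoHom i) w
  | braid i j h =>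
    simp only [map_mul, map_inv, mul_inv_eq_one, VBGen.s, VBGen.r, FreeGroup.lift_apply_of]
    apply MulOpposite.unop_injective
    simp only [MulOpposite.unop_mul, gen, MulOpposite.unop_op]
    obtain ⟨e, e1, e2, e3, e4, e5⟩ := VB.adj h
    have hs := sigmaHom_hi i
    have hr := rhoHom_hi i
    rw [e] at hs hr
    refine aut_ext_four (lo i) (hi i) (lo j) (hi j) ?_ ?_ ?_ ?_ (fun k h1 h2 h3 h4 => ?_) ?_ <;>
    simp [MulAut.mul_apply, sigmaAut_apply, rhoAut_apply, sigmaHom_lo, sigmaHom_hi, sigmaHom_ne,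
      sigmaHom_Y, rhoHom_lo, rhoHom_hi, rhoHom_ne, rhoHom_Y, mul_assoc, *]
  | vbraid i j h =>
    simp only [map_mul, map_inv, mul_inv_eq_one, VBGen.s, VBGen.r, FreeGroup.lift_apply_of]
    apply MulOpposite.unop_injective
    simp only [MulOpposite.unop_mul, gen, MulOpposite.unop_op]
    obtain ⟨e, e1, e2, e3, e4, e5⟩ := VB.adj h
    have hs := sigmaHom_hi i
    have hr := rhoHom_hi i
    rw [e] at hs hr
    refine aut_ext_four (lo i) (hi i) (lo j) (hi j) ?_ ?_ ?_ ?_ (fun k h1 h2 h3 h4 => ?_) ?_ <;>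
    simp [MulAut.mul_apply, sigmaAut_apply, rhoAut_apply, sigmaHom_lo, sigmaHom_hi, sigmaHom_ne,
      sigmaHom_Y, rhoHom_lo, rhoHom_hi, rhoHom_ne, rhoHom_Y, mul_assoc, *]
  | mixed i j h =>
    simp only [map_mul, map_inv, mul_inv_eq_one, VBGen.s, VBGen.r, FreeGroup.lift_apply_of]
    apply MulOpposite.unop_injective
    simp only [MulOpposite.unop_mul, gen, MulOpposite.unop_op]
    obtain ⟨e, e1, e2, e3, e4, e5⟩ := VB.adj h
    have hs := sigmaHom_hi i
    have hr := rhoHom_hi i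
    rw [e] at hs hr
    refine aut_ext_four (lo i) (hi i) (lo j) (hi j) ?_ ?_ ?_ ?_ (fun k h1 h2 h3 h4 => ?_) ?_ <;>
    simp [MulAut.mul_apply, sigmaAut_apply, rhoAut_apply, sigmaHom_lo, sigmaHom_hi, sigmaHom_ne,
      sigmaHom_Y, rhoHom_lo, rhoHom_hi, rhoHom_ne, rhoHom_Y, mul_assoc, *]
  | comm i j h =>
    simp only [map_mul, map_inv, mul_inv_eq_one, VBGen.s, VBGen.r, FreeGroup.lift_apply_of]
    apply MulOpposite.unop_injective
    simp only [MulOpposite.unop_mul, gen, MulOpposite.unop_op]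
    obtain ⟨e1, e2, e3, e4, e5, e6, e7, e8⟩ := VB.far h
    refine aut_ext_four (lo i) (hi i) (lo j) (hi j) ?_ ?_ ?_ ?_ (fun k h1 h2 h3 h4 => ?_) ?_ <;>
    simp [MulAut.mul_apply, sigmaAut_apply, rhoAut_apply, sigmaHom_lo, sigmaHom_hi, sigmaHom_ne,
      sigmaHom_Y, rhoHom_lo, rhoHom_hi, rhoHom_ne, rhoHom_Y, mul_assoc, *]
  | vcomm i j h =>
    simp only [map_mul, map_inv, mul_inv_eq_one, VBGen.s, VBGen.r, FreeGroup.lift_apply_of]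
    apply MulOpposite.unop_injective
    simp only [MulOpposite.unop_mul, gen, MulOpposite.unop_op]
    obtain ⟨e1, e2, e3, e4, e5, e6, e7, e8⟩ := VB.far h
    refine aut_ext_four (lo i) (hi i) (lo j) (hi j) ?_ ?_ ?_ ?_ (fun k h1 h2 h3 h4 => ?_) ?_ <;>
    simp [MulAut.mul_apply, sigmaAut_apply, rhoAut_apply, sigmaHom_lo, sigmaHom_hi, sigmaHom_ne,
      sigmaHom_Y, rhoHom_lo, rhoHom_hi, rhoHom_ne, rhoHom_Y, mul_assoc, *]
  | mcomm i j h =>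
    simp only [map_mul, map_inv, mul_inv_eq_one, VBGen.s, VBGen.r, FreeGroup.lift_apply_of]
    apply MulOpposite.unop_injective
    simp only [MulOpposite.unop_mul, gen, MulOpposite.unop_op]
    obtain ⟨e1, e2, e3, e4, e5, e6, e7, e8⟩ := VB.far h
    refine aut_ext_four (lo i) (hi i) (lo j) (hi j) ?_ ?_ ?_ ?_ (fun k h1 h2 h3 h4 => ?_) ?_ <;>
    simp [MulAut.mul_apply, sigmaAut_apply, rhoAut_apply, sigmaHom_lo, sigmaHom_hi, sigmaHom_ne,
      sigmaHom_Y, rhoHom_lo, rhoHom_hi, rhoHom_ne, rhoHom_Y, mul_assoc, *]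

end PhiA

/-- The representation `φ_A` of `VB_n` by automorphisms of `F_{n+1}` acting on the right. -/
def phiA (n : ℕ) : VB n →* (MulAut (FreeGroup (FGen n)))ᵐᵒᵖ :=
  PresentedGroup.toGroup (PhiA.gen_rel n)

/-- The group `G_A(β)` of (the closure of) a virtual braid `β ∈ VB_n`: generators
`x_0, …, x_{n-1}, y`, and a relation `h = φ_A(β)(h)` for every generator `h`. -/
abbrev GA {n : ℕ} (β : VB n) : Type :=
  PresentedGroup {w : FreeGroup (FGen n) |
    ∃ h : FGen n, w = FreeGroup.of h * ((phiA n β).unop (FreeGroup.of h))⁻¹}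

/-- The virtual trefoil as the closure of the virtual braid `σ_1⁻² ρ_1 ∈ VB_2`. -/
def virtualTrefoil : VB 2 := (VB.σ 0)⁻¹ ^ 2 * VB.ρ 0

/-! ## The one-relator presentation and residual nilpotence -/

/-- The commutator `[a, b] = a⁻¹ b⁻¹ a b`. -/
def cmt {G : Type*} [Group G] (a b : G) : G := a⁻¹ * b⁻¹ * a * b

/-- The left-normalized commutator `[x⁻¹, y, x⁻¹, y x⁻¹] = [[[x⁻¹, y], x⁻¹], y x⁻¹]` in the free
group on `x = of 0` and `y = of 1`. -/
def trefoilRelator : FreeGroup (Fin 2) :=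
  cmt (cmt (cmt (FreeGroup.of 0)⁻¹ (FreeGroup.of 1)) (FreeGroup.of 0)⁻¹)
    (FreeGroup.of 1 * (FreeGroup.of 0)⁻¹)

/-- A nontrivial group is residually nilpotent if every element other than `1` survives under a
homomorphism to some nilpotent group. -/
def IsResiduallyNilpotent.{u} (G : Type u) [Group G] : Prop :=
  Nontrivial G ∧ ∀ g : G, g ≠ 1 →
    ∃ (N : Type u) (_ : Group N) (φ : G →* N), Group.IsNilpotent N ∧ φ g ≠ 1

/-!
The group of the virtual trefoil is a mapping torus of a free group of rank three with unipotent
monodromy, and such groups are residually nilpotent.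

Eliminating one generator from `G_A` gives the one-relator presentation
(`VirtualTrefoil.nonempty_mulEquiv`). Put `t = y x⁻¹`, `U = x⁻¹ y x⁻¹`, `d = U⁻¹ (t U t⁻¹)` and
`c = U d U⁻¹ (t d t⁻¹)⁻¹`. Then `t`, `U` generate the group, and the relator is conjugate to the
commutator of `c` and `t` (`cmt_trefoil`). Hence conjugation by `t` acts on `F = ⟨U, d, c⟩` by
`U ↦ U d`, `d ↦ c⁻¹ U d U⁻¹`, `c ↦ c`. This is an automorphism of the free group on `U`, `d`, `c`,
and the group is `F ⋊ ⟨t⟩`; only its embedding in `F ⋊ ⟨t⟩` is needed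
(`TrefoilGroup.fromMappingTorus_toMappingTorus`).

Give `U`, `d`, `c` the weights `1`, `2`, `3`, and filter `F` by the smallest subgroups in which
weights add up under commutators (`WeightedSeries`). The monodromy changes each generator only by
elements of greater weight, so it acts trivially on the graded pieces of the filtration
(`WeightedSeries.map_mul_inv`, `monodromy_mem_trivialOnGraded`). Therefore the lower central series
of `F ⋊ ⟨t⟩` descends at least as fast as the filtration (`exists_nilpotent_of_trivialOnGraded`).

The filtration has trivial intersection (`WeightedSeries.exists_not`) by Magnus' argument: `F` acts
on functions on words, a generator `x_i` acting as `1 + X_i` with `X_i ^ 2 = 0`. Elements of large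
depth change a function only on words of large weight, while a reduced product of syllables
`x_i ^ e` takes the function `1` of the empty word to one with coefficient the product of the
exponents, which is not zero, at the word of its letters (`Magnus.act_syllableProd`).
-/

open scoped commutatorElement

/-! ### The weighted central filtration of a free group -/

/-- `WeightedSeries w n f` says that `f` lies in the `n`-th term of the fastest descending filtration
of the free group by subgroups in which the generator `i` has depth at least `w i` and depths add up
under commutators. For `w = 1` and `n ≥ 1` this is the lower central series. -/
inductive WeightedSeries {ι : Type*} (w : ι → ℕ) : ℕ → FreeGroup ι → Prop
  | of (i : ι) : WeightedSeries w (w i) (FreeGroup.of i)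
  | one (n : ℕ) : WeightedSeries w n 1
  | mul {n : ℕ} {f g : FreeGroup ι} :
      WeightedSeries w n f → WeightedSeries w n g → WeightedSeries w n (f * g)
  | inv {n : ℕ} {f : FreeGroup ι} : WeightedSeries w n f → WeightedSeries w n f⁻¹
  | comm {k l : ℕ} {f g : FreeGroup ι} :
      WeightedSeries w k f → WeightedSeries w l g → WeightedSeries w (k + l) ⁅f, g⁆
  | mono {m n : ℕ} {f : FreeGroup ι} (h : m ≤ n) : WeightedSeries w n f → WeightedSeries w m f

namespace WeightedSeries

variable {ι : Type*} {w : ι → ℕ}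

/-- If all weights are at least `n`, the `n`-th term of the filtration is everything. -/
theorem of_le {n : ℕ} (hw : ∀ i, n ≤ w i) (f : FreeGroup ι) : WeightedSeries w n f := by
  induction f using FreeGroup.induction_on with
  | C1 => exact one n
  | of i => exact (of i).mono (hw i)
  | inv_of i h => exact h.inv
  | mul f g hf hg => exact hf.mul hg

theorem conj {n : ℕ} {f : FreeGroup ι} (hf : WeightedSeries w n f) (h : FreeGroup ι) :
    WeightedSeries w n (h * f * h⁻¹) := by
  have := (((of_le (w := w) (fun i => Nat.zero_le (w i)) h).comm hf).mono (by simp)).mul hf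
  simpa [commutatorElement_def] using this

theorem conj' {n : ℕ} {f : FreeGroup ι} (hf : WeightedSeries w n f) (h : FreeGroup ι) :
    WeightedSeries w n (h⁻¹ * f * h) := by
  simpa using hf.conj h⁻¹

variable (w) in
/-- The `n`-th term of the weighted filtration, as a subgroup. -/
def subgroup (n : ℕ) : Subgroup (FreeGroup ι) where
  carrier := {f | WeightedSeries w n f}
  mul_mem' := mul
  one_mem' := one n
  inv_mem' := inv

theorem mem_subgroup {n : ℕ} {f : FreeGroup ι} : f ∈ subgroup w n ↔ WeightedSeries w n f := Iff.rfl

instance (n : ℕ) : (subgroup w n).Normal := ⟨fun _ hf h => conj hf h⟩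

/-- Modulo the `n`-th term, elements commute as soon as their depths add up to at least `n`. -/
theorem commute_mk {n k l : ℕ} {f g : FreeGroup ι} (hf : WeightedSeries w k f)
    (hg : WeightedSeries w l g) (h : n ≤ k + l) :
    Commute (f : FreeGroup ι ⧸ subgroup w n) (g : FreeGroup ι ⧸ subgroup w n) := by
  rw [← commutatorElement_eq_one_iff_commute]
  have : ((⁅f, g⁆ : FreeGroup ι) : FreeGroup ι ⧸ subgroup w n) = 1 :=
    (QuotientGroup.eq_one_iff _).2 ((hf.comm hg).mono h)
  exact this

/-- A commutator does not change when its entries are multiplied by elements that commute with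
enough of what is left. -/
theorem commutatorElement_mul_mul {Q : Type*} [Group Q] {f f' g g' : Q}
    (h1 : Commute f' (f * g * f⁻¹)) (h2 : Commute g' (f' * f)) (h3 : Commute g' ⁅f, g⁆) :
    ⁅f' * f, g' * g⁆ = ⁅f, g⁆ := by
  calc ⁅f' * f, g' * g⁆ = (f' * f * g') * g * f⁻¹ * f'⁻¹ * g⁻¹ * g'⁻¹ := by
        rw [commutatorElement_def]; group
    _ = g' * (f' * (f * g * f⁻¹)) * f'⁻¹ * g⁻¹ * g'⁻¹ := by rw [← h2.eq]; group
    _ = g' * ⁅f, g⁆ * g'⁻¹ := by rw [h1.eq, commutatorElement_def]; group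
    _ = ⁅f, g⁆ := by rw [h3.eq]; group

/-- An endomorphism that moves every generator only by something deeper than its weight acts
trivially on all the quotients of consecutive terms. -/
theorem map_mul_inv {α : FreeGroup ι →* FreeGroup ι}
    (hα : ∀ i, WeightedSeries w (w i + 1) (α (FreeGroup.of i) * (FreeGroup.of i)⁻¹))
    {n : ℕ} {f : FreeGroup ι} (hf : WeightedSeries w n f) :
    WeightedSeries w (n + 1) (α f * f⁻¹) := by
  induction hf with
  | of i => exact hα i
  | one n => simpa using one (n + 1)
  | @mul n f g _ _ ihf ihg =>
    have : α (f * g) * (f * g)⁻¹ = (α f * f⁻¹) * (f * (α g * g⁻¹) * f⁻¹) := by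
      rw [map_mul]; group
    rw [this]
    exact ihf.mul (ihg.conj f)
  | @inv n f _ ih =>
    have : α f⁻¹ * f⁻¹⁻¹ = f⁻¹ * (α f * f⁻¹)⁻¹ * f⁻¹⁻¹ := by
      rw [map_inv]; group
    rw [this]
    exact ih.inv.conj f⁻¹
  | @comm k l f g hf hg ihf ihg =>
    obtain ⟨f', hf'⟩ : ∃ f', f' = α f * f⁻¹ := ⟨_, rfl⟩
    obtain ⟨g', hg'⟩ : ∃ g', g' = α g * g⁻¹ := ⟨_, rfl⟩
    have ef : α f = f' * f := by rw [hf']; group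
    have eg : α g = g' * g := by rw [hg']; group
    rw [← hf'] at ihf
    rw [← hg'] at ihg
    rw [map_commutatorElement, ef, eg, ← mem_subgroup, ← QuotientGroup.eq_one_iff,
      QuotientGroup.mk_mul, QuotientGroup.mk_inv, mul_inv_eq_one]
    exact commutatorElement_mul_mul (f := (f : FreeGroup ι ⧸ subgroup w (k + l + 1))) (f' := f')
      (g := g) (g' := g')
      (commute_mk (n := k + l + 1) ihf (hg.conj f) (by omega))
      (commute_mk (n := k + l + 1) ihg ((ihf.mono (by omega)).mul hf) (by omega))
      (commute_mk (n := k + l + 1) ihg (hf.comm hg) (by omega))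
  | mono h _ ih => exact ih.mono (by omega)

variable (w) in
/-- The automorphisms that, together with their inverses, act trivially on the quotients of
consecutive terms of the weighted filtration. -/
def trivialOnGraded : Subgroup (MulAut (FreeGroup ι)) where
  carrier := {α | ∀ n f, WeightedSeries w n f →
    WeightedSeries w (n + 1) (α f * f⁻¹) ∧ WeightedSeries w (n + 1) (α⁻¹ f * f⁻¹)}
  one_mem' n f _ := by simpa using one (n + 1)
  mul_mem' {α β} hα hβ n f hf := by
    have key : ∀ γ δ : MulAut (FreeGroup ι),
        (∀ n f, WeightedSeries w n f → WeightedSeries w (n + 1) (γ f * f⁻¹)) →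
        (∀ n f, WeightedSeries w n f → WeightedSeries w (n + 1) (δ f * f⁻¹)) →
        WeightedSeries w (n + 1) ((γ * δ) f * f⁻¹) := by
      intro γ δ hγ hδ
      have h1 := hδ n f hf
      have h2 : WeightedSeries w n (δ f) := by
        simpa using (h1.mono (Nat.le_succ n)).mul hf
      simpa [mul_assoc] using (hγ n _ h2).mul h1
    refine ⟨key α β (fun n f h => (hα n f h).1) (fun n f h => (hβ n f h).1), ?_⟩
    rw [mul_inv_rev]
    exact key β⁻¹ α⁻¹ (fun n f h => (hβ n f h).2) (fun n f h => (hα n f h).2)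
  inv_mem' {α} hα n f hf := ⟨(hα n f hf).2, by simpa using (hα n f hf).1⟩

end WeightedSeries

/-! ### The filtration is separated -/

namespace Magnus

variable {ι : Type*}

/-- The total weight of a word. -/
def weight (w : ι → ℕ) (u : List ι) : ℕ := (u.map w).sum

/-- The functions that vanish on all words of weight less than `n`. -/
def V (w : ι → ℕ) (n : ℕ) : Submodule ℤ (List ι → ℤ) where
  carrier := {v | ∀ u, weight w u < n → v u = 0}
  add_mem' ha hb u h := by simp [ha u h, hb u h]
  zero_mem' _ _ := rfl
  smul_mem' a v hv u h := by simp [hv u h]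

variable {w : ι → ℕ}

theorem V_mono {m n : ℕ} (h : m ≤ n) {v : List ι → ℤ} (hv : v ∈ V w n) : v ∈ V w m :=
  fun u hu => hv u (hu.trans_le h)

/-- The product of the syllables `i ^ e`, for `(i, e)` running through `L`. -/
def syllableProd (L : List (ι × ℤ)) : FreeGroup ι := (L.map fun s => FreeGroup.of s.1 ^ s.2).prod

/-- A reduced syllable list: exponents are nonzero and adjacent letters are different. -/
def IsSyllables (L : List (ι × ℤ)) : Prop :=
  (∀ s ∈ L, s.2 ≠ 0) ∧ (L.map Prod.fst).IsChain (· ≠ ·)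

variable [DecidableEq ι]

/-- The operator `X i` on integer-valued functions on words: prepend the letter `i`, words with two
equal adjacent letters being zero, so that `X i ^ 2 = 0`. -/
def X (i : ι) : Module.End ℤ (List ι → ℤ) where
  toFun v
    | [] => 0
    | j :: u => if i = j ∧ u.head? ≠ some i then v u else 0
  map_add' v v' := by
    funext u
    cases u with
    | nil => simp
    | cons j u =>
      simp only [Pi.add_apply]
      split_ifs <;> simp
  map_smul' a v := by
    funext u
    cases u with
    | nil => simp
    | cons j u =>
      simp only [Pi.smul_apply, RingHom.id_apply]
      split_ifs <;> simp

theorem X_nil (i : ι) (v : List ι → ℤ) : X i v [] = 0 := rfl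

theorem X_cons (i j : ι) (u : List ι) (v : List ι → ℤ) :
    X i v (j :: u) = if i = j ∧ u.head? ≠ some i then v u else 0 := rfl

theorem X_mul_X (i : ι) : X i * X i = 0 := by
  ext v u
  match u with
  | [] => rfl
  | [j] => simp [Module.End.mul_apply, X_cons, X_nil]
  | j :: k :: u =>
    by_cases h : k = i
    · simp [Module.End.mul_apply, X_cons, h]
    · simp [Module.End.mul_apply, X_cons, h, Ne.symm h]

/-- The unit `1 + X i`, with inverse `1 - X i`. -/
def unit (i : ι) : (Module.End ℤ (List ι → ℤ))ˣ where
  val := 1 + X i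
  inv := 1 - X i
  val_inv := by simp [mul_sub, add_mul, X_mul_X]
  inv_val := by simp [mul_add, sub_mul, X_mul_X]

/-- The Magnus representation with `X i ^ 2 = 0`. -/
def rep : FreeGroup ι →* (Module.End ℤ (List ι → ℤ))ˣ := FreeGroup.lift unit

/-- The action of `f` on functions on words. -/
def act (f : FreeGroup ι) : Module.End ℤ (List ι → ℤ) := (rep f : Module.End ℤ (List ι → ℤ))

theorem act_one (v : List ι → ℤ) : act (1 : FreeGroup ι) v = v := by simp [act]

theorem act_mul (f g : FreeGroup ι) (v : List ι → ℤ) : act (f * g) v = act f (act g v) := by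
  simp [act]

theorem act_of (i : ι) (v : List ι → ℤ) : act (FreeGroup.of i) v = v + X i v := by
  simp [act, rep, unit]

theorem act_of_inv (i : ι) (v : List ι → ℤ) : act (FreeGroup.of i)⁻¹ v = v - X i v := by
  simp [act, rep, unit]

theorem act_of_zpow (i : ι) (e : ℤ) (v : List ι → ℤ) :
    act (FreeGroup.of i ^ e) v = v + e • X i v := by
  have hX : ∀ v, X i (X i v) = 0 := fun v => DFunLike.congr_fun (X_mul_X i) v
  induction e generalizing v with
  | zero => simp [act_one]
  | succ n ih =>
    rw [zpow_add_one, act_mul, ih, act_of, map_add, hX]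
    module
  | pred n ih =>
    rw [zpow_sub_one, act_mul, ih, act_of_inv, map_sub, hX]
    module

theorem X_mem {n : ℕ} (i : ι) {v : List ι → ℤ} (hv : v ∈ V w n) : X i v ∈ V w (n + w i) := by
  rintro (_ | ⟨j, u⟩) h
  · rfl
  · rw [X_cons]
    split_ifs with hc
    · obtain ⟨rfl, -⟩ := hc
      exact hv u (by simp [weight] at h ⊢; omega)
    · rfl

theorem act_mem {n : ℕ} (f : FreeGroup ι) {v : List ι → ℤ} (hv : v ∈ V w n) :
    act f v ∈ V w n := by
  induction f using FreeGroup.induction_on generalizing v with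
  | C1 => rwa [act_one]
  | of i =>
    rw [act_of]
    exact add_mem hv (V_mono (by omega) (X_mem i hv))
  | inv_of i =>
    rw [act_of_inv]
    exact sub_mem hv (V_mono (by omega) (X_mem i hv))
  | mul f g hf hg =>
    rw [act_mul]
    exact hf (hg hv)

/-- An element of depth `n` moves every function by something deeper by at least `n`. -/
theorem act_sub_mem {n : ℕ} {f : FreeGroup ι} (hf : WeightedSeries w n f) {k : ℕ}
    {v : List ι → ℤ} (hv : v ∈ V w k) : act f v - v ∈ V w (k + n) := by
  induction hf generalizing k v with
  | of i =>
    rw [act_of, add_sub_cancel_left]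
    exact X_mem i hv
  | one n => simp [act_one]
  | @mul n f g _ _ ihf ihg =>
    have : act (f * g) v - v = act f (act g v - v) + (act f v - v) := by
      rw [act_mul, map_sub]; abel
    rw [this]
    exact add_mem (act_mem f (ihg hv)) (ihf hv)
  | @inv n f _ ih =>
    have : act f⁻¹ v - v = -act f⁻¹ (act f v - v) := by
      rw [map_sub, ← act_mul, inv_mul_cancel, act_one]; abel
    rw [this]
    exact neg_mem (act_mem _ (ih hv))
  | @comm a b f g _ _ ihf ihg =>
    have hu : act (f⁻¹ * g⁻¹) v ∈ V w k := act_mem _ hv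
    set u := act (f⁻¹ * g⁻¹) v with hudef
    have e1 : act ⁅f, g⁆ v = act f (act g u) := by
      rw [hudef, ← act_mul, ← act_mul, commutatorElement_def]
      congr 2
      group
    have e2 : v = act g (act f u) := by
      rw [hudef, ← act_mul, ← act_mul]
      simp [mul_assoc, act_one]
    have e3 : act ⁅f, g⁆ v - v = (act f (act g u - u) - (act g u - u)) -
        (act g (act f u - u) - (act f u - u)) := by
      calc act ⁅f, g⁆ v - v = act f (act g u) - act g (act f u) := by rw [e1, ← e2]
        _ = _ := by simp only [map_sub]; abel
    rw [e3]
    exact sub_mem (V_mono (by omega) (ihf (ihg hu))) (V_mono (by omega) (ihg (ihf hu)))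
  | mono h _ ih => exact V_mono (by omega) (ih hv)

/-- Multiplication by a power of a generator merges with, cancels, or precedes the first syllable. -/
theorem exists_syllables_zpow_mul (i : ι) (e : ℤ) {L : List (ι × ℤ)} (hL : IsSyllables L) :
    ∃ L', IsSyllables L' ∧ syllableProd L' = FreeGroup.of i ^ e * syllableProd L := by
  by_cases he : e = 0
  · exact ⟨L, hL, by simp [he]⟩
  match L, hL with
  | [], _ => exact ⟨[(i, e)], by simp [IsSyllables, he], by simp [syllableProd]⟩
  | (j, a) :: L, ⟨h1, h2⟩ =>
    by_cases hij : i = j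
    · subst hij
      have h1' : ∀ s ∈ L, s.2 ≠ 0 := fun s hs => h1 s (List.mem_cons_of_mem _ hs)
      by_cases hea : e + a = 0
      · refine ⟨L, ⟨h1', ?_⟩, ?_⟩
        · rw [List.map_cons] at h2
          exact h2.tail
        · simp [syllableProd, ← mul_assoc, ← zpow_add, hea]
      · refine ⟨(i, e + a) :: L, ⟨?_, h2⟩, ?_⟩
        · intro s hs
          rcases List.mem_cons.1 hs with rfl | hs
          · exact hea
          · exact h1' s hs
        · simp [syllableProd, ← mul_assoc, ← zpow_add]
    · refine ⟨(i, e) :: (j, a) :: L, ⟨?_, ?_⟩, by simp [syllableProd]⟩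
      · intro s hs
        rcases List.mem_cons.1 hs with rfl | hs
        · exact he
        · exact h1 s hs
      · simp only [List.map_cons] at h2 ⊢
        exact List.isChain_cons_cons.2 ⟨hij, h2⟩

theorem exists_syllables (f : FreeGroup ι) : ∃ L, IsSyllables L ∧ syllableProd L = f := by
  suffices h : ∀ L, IsSyllables L → ∃ L', IsSyllables L' ∧ syllableProd L' = f * syllableProd L by
    simpa [syllableProd] using h [] (by simp [IsSyllables])
  induction f using FreeGroup.induction_on with
  | C1 => exact fun L hL => ⟨L, hL, by simp⟩
  | of i => exact fun L hL => by simpa using exists_syllables_zpow_mul i 1 hL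
  | inv_of i => exact fun L hL => by simpa using exists_syllables_zpow_mul i (-1) hL
  | mul f g hf hg =>
    intro L hL
    obtain ⟨L1, h1, e1⟩ := hg L hL
    obtain ⟨L2, h2, e2⟩ := hf L1 h1
    exact ⟨L2, h2, by rw [e2, e1, mul_assoc]⟩

/-- The function `1` of the empty word is moved to one whose longest word is the word of letters of
the syllables; its coefficient is the product of the exponents. -/
theorem act_syllableProd {L : List (ι × ℤ)} (hL : IsSyllables L) :
    act (syllableProd L) (Pi.single [] 1) (L.map Prod.fst) ≠ 0 ∧
    ∀ u : List ι, L.length < u.length → act (syllableProd L) (Pi.single [] 1) u = 0 := by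
  induction L with
  | nil =>
    refine ⟨by simp [syllableProd, act_one], fun u hu => ?_⟩
    have : u ≠ [] := by rintro rfl; simp at hu
    simp [syllableProd, act_one, this]
  | cons s L ih =>
    obtain ⟨h1, h2⟩ := hL
    rw [List.map_cons] at h2
    obtain ⟨ih1, ih2⟩ := ih ⟨fun s hs => h1 s (List.mem_cons_of_mem _ hs), h2.tail⟩
    have e : syllableProd (s :: L) = FreeGroup.of s.1 ^ s.2 * syllableProd L := by
      simp [syllableProd]
    rw [e, act_mul, act_of_zpow]
    constructor
    · have hh : (L.map Prod.fst).head? ≠ some s.1 := by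
        cases L with
        | nil => simp
        | cons s' L =>
          simp only [List.map_cons] at h2
          simpa using (List.isChain_cons_cons.1 h2).1.symm
      simp only [List.map_cons, Pi.add_apply, Pi.smul_apply, X_cons, hh, ne_eq, not_false_eq_true,
        and_self, if_true]
      rw [ih2 _ (by simp), zero_add, smul_eq_mul]
      exact mul_ne_zero (h1 s (by simp)) ih1
    · rintro (_ | ⟨j, u⟩) hu
      · simp at hu
      · simp only [List.length_cons] at hu
        rw [Pi.add_apply, Pi.smul_apply, X_cons, ih2 _ (by simp; omega)]
        split_ifs
        · rw [ih2 u (by omega)]; simp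
        · simp

end Magnus

/-- The terms of the weighted filtration have trivial intersection. -/
theorem WeightedSeries.exists_not {ι : Type*} (w : ι → ℕ) {f : FreeGroup ι} (hf : f ≠ 1) :
    ∃ n, ¬ WeightedSeries w n f := by
  classical
  obtain ⟨L, hL, rfl⟩ := Magnus.exists_syllables f
  have hne : L.map Prod.fst ≠ [] := by
    intro h
    rw [List.map_eq_nil_iff] at h
    exact hf (by simp [h, Magnus.syllableProd])
  refine ⟨Magnus.weight w (L.map Prod.fst) + 1, fun hn => (Magnus.act_syllableProd hL).1 ?_⟩
  have h0 : (Pi.single [] 1 : List ι → ℤ) ∈ Magnus.V w 0 := fun u hu => absurd hu (Nat.not_lt_zero _)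
  have := Magnus.act_sub_mem hn h0 (L.map Prod.fst) (by omega)
  simpa [hne] using this

/-! ### Residual nilpotence of extensions of a free group by an abelian group -/

/-- If the abelian group `A` acts on a free group trivially on the graded pieces of a weighted
filtration with positive weights, the semidirect product is residually nilpotent: its lower central
series is bounded by the filtration. -/
theorem exists_nilpotent_of_trivialOnGraded {ι A : Type} [CommGroup A]
    (φ : A →* MulAut (FreeGroup ι)) {w : ι → ℕ} (hw : ∀ i, 1 ≤ w i)
    (hφ : ∀ a, φ a ∈ WeightedSeries.trivialOnGraded w) (g : FreeGroup ι ⋊[φ] A) (hg : g ≠ 1) :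
    ∃ (N : Type) (_ : Group N) (ψ : FreeGroup ι ⋊[φ] A →* N), Group.IsNilpotent N ∧ ψ g ≠ 1 := by
  -- elements outside the free group survive in the abelian quotient `A`
  by_cases hr : g.right = 1
  swap
  · exact ⟨A, inferInstance, SemidirectProduct.rightHom, inferInstance, hr⟩
  let H : ℕ → Subgroup (FreeGroup ι ⋊[φ] A)
    | 0 => ⊤
    | n + 1 => (WeightedSeries.subgroup w (n + 1)).map SemidirectProduct.inl
  have mem_H : ∀ n (x : FreeGroup ι ⋊[φ] A), x.right = 1 → WeightedSeries w (n + 1) x.left →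
      x ∈ H (n + 1) := fun n x h1 h2 => ⟨x.left, h2, by ext <;> simp [h1]⟩
  have hH : Subgroup.IsDescendingCentralSeries H := by
    refine ⟨rfl, fun x n hx y => ?_⟩
    refine mem_H n _ (by simp [commutatorElement_def]) ?_
    cases n with
    | zero => exact WeightedSeries.of_le hw _
    | succ n =>
      obtain ⟨f, hf, rfl⟩ := hx
      -- with `φ f = f' f`, the commutator in the semidirect product is `⁅f, y⁆` times a conjugate
      -- of `f'⁻¹`, and `f'` is one step deeper than `f`
      have e : ⁅(SemidirectProduct.inl f : FreeGroup ι ⋊[φ] A), y⁆.left =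
          ⁅f, y.left⁆ * (y.left * (φ y.right f * f⁻¹)⁻¹ * y.left⁻¹) := by
        simp only [commutatorElement_def, SemidirectProduct.mul_left, SemidirectProduct.left_inl,
          SemidirectProduct.right_inl, SemidirectProduct.inv_left, SemidirectProduct.mul_right,
          SemidirectProduct.inv_right, map_one, map_inv, MulAut.one_apply, inv_one, one_mul,
          mul_one, MulAut.apply_inv_self]
        group
      rw [e]
      exact (hf.comm (WeightedSeries.of_le hw y.left)).mul
        (((hφ y.right (n + 1) f hf).1.inv).conj y.left)
  obtain ⟨f, rfl⟩ : ∃ f, SemidirectProduct.inl f = g := ⟨g.left, by ext <;> simp [hr]⟩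
  have hf : f ≠ 1 := by rintro rfl; simp at hg
  obtain ⟨n, hn⟩ := WeightedSeries.exists_not w hf
  let S := (⊤ : Subgroup (FreeGroup ι ⋊[φ] A)).lowerCentralSeries (n + 1)
  refine ⟨_ ⧸ S, inferInstance, QuotientGroup.mk' S, ?_, ?_⟩
  · rw [Subgroup.nilpotent_iff_lowerCentralSeries]
    refine ⟨n + 1, ?_⟩
    rw [← Subgroup.map_top_of_surjective _ (QuotientGroup.mk'_surjective S),
      ← Subgroup.map_lowerCentralSeries]
    exact (QuotientGroup.map_mk'_self S)
  · intro h
    have h1 : SemidirectProduct.inl f ∈ S := (QuotientGroup.eq_one_iff _).1 h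
    obtain ⟨f', hf', e⟩ := Subgroup.descending_central_series_ge_lower H hH (n + 1) h1
    rw [SemidirectProduct.inl_injective e] at hf'
    exact hn (hf'.mono (Nat.le_succ n))

/-! ### The trefoil group as an extension of a free group by an infinite cyclic group -/

/-- The monodromy on `F = ⟨U, d, c⟩`, with `U`, `d`, `c` numbered `0`, `1`, `2`:
`U ↦ U d`, `d ↦ c⁻¹ U d U⁻¹`, `c ↦ c`. -/
def monodromyHom : FreeGroup (Fin 3) →* FreeGroup (Fin 3) :=
  FreeGroup.lift ![FreeGroup.of 0 * FreeGroup.of 1,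
    (FreeGroup.of 2)⁻¹ * FreeGroup.of 0 * FreeGroup.of 1 * (FreeGroup.of 0)⁻¹, FreeGroup.of 2]

/-- The inverse of the monodromy: `U ↦ d⁻¹ c⁻¹ U`, `d ↦ U⁻¹ c d U`, `c ↦ c`. -/
def monodromyInvHom : FreeGroup (Fin 3) →* FreeGroup (Fin 3) :=
  FreeGroup.lift ![(FreeGroup.of 1)⁻¹ * (FreeGroup.of 2)⁻¹ * FreeGroup.of 0,
    (FreeGroup.of 0)⁻¹ * FreeGroup.of 2 * FreeGroup.of 1 * FreeGroup.of 0, FreeGroup.of 2]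

/-- The monodromy as an automorphism. -/
def monodromy : MulAut (FreeGroup (Fin 3)) :=
  MonoidHom.toMulEquiv monodromyHom monodromyInvHom
    (by
      apply FreeGroup.ext_hom
      intro i
      fin_cases i <;> simp [monodromyHom, monodromyInvHom, mul_assoc])
    (by
      apply FreeGroup.ext_hom
      intro i
      fin_cases i <;> simp [monodromyHom, monodromyInvHom, mul_assoc])

theorem monodromy_apply (f : FreeGroup (Fin 3)) : monodromy f = monodromyHom f := rfl

theorem monodromy_inv_apply (f : FreeGroup (Fin 3)) : monodromy⁻¹ f = monodromyInvHom f := rfl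

/-- With the weights `1`, `2`, `3` for `U`, `d`, `c`, the monodromy is trivial on the graded
pieces: it moves `U` by a conjugate of `d`, and `d` by `c⁻¹` and a commutator of `U` and `d`. -/
theorem monodromy_mem_trivialOnGraded :
    monodromy ∈ WeightedSeries.trivialOnGraded (fun i : Fin 3 => (i : ℕ) + 1) := by
  have hU := WeightedSeries.of (w := fun i : Fin 3 => (i : ℕ) + 1) 0
  have hd := WeightedSeries.of (w := fun i : Fin 3 => (i : ℕ) + 1) 1
  have hc := WeightedSeries.of (w := fun i : Fin 3 => (i : ℕ) + 1) 2
  intro n f hf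
  rw [monodromy_apply, monodromy_inv_apply]
  constructor
  · refine WeightedSeries.map_mul_inv (fun i => ?_) hf
    fin_cases i
    · simpa [monodromyHom] using hd.conj (FreeGroup.of 0)
    · simpa [monodromyHom, commutatorElement_def, mul_assoc] using hc.inv.mul (hU.comm hd)
    · simpa [monodromyHom] using WeightedSeries.one _
  · refine WeightedSeries.map_mul_inv (fun i => ?_) hf
    fin_cases i
    · simpa [monodromyInvHom] using hd.inv.mul (hc.inv.mono (by simp))
    · simpa [monodromyInvHom, commutatorElement_def, mul_assoc] using
        (hc.conj' (FreeGroup.of 0)).mul (hU.inv.comm hd)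
    · simpa [monodromyInvHom] using WeightedSeries.one _

/-- The action of the infinite cyclic group through the monodromy. -/
def monodromyAction : Multiplicative ℤ →* MulAut (FreeGroup (Fin 3)) := zpowersHom _ monodromy

theorem monodromyAction_apply (a : Multiplicative ℤ) :
    monodromyAction a = monodromy ^ a.toAdd := rfl

/-- In terms of `t = y x⁻¹` and `U = x⁻¹ y x⁻¹`, i.e. `x = t U⁻¹` and `y = t t U⁻¹`, the trefoil
relator says that `t` commutes with `c = U d U⁻¹ (t d t⁻¹)⁻¹`, where `d = U⁻¹ (t U t⁻¹)`. -/
theorem cmt_trefoil {G : Type*} [Group G] (t U : G) :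
    cmt (cmt (cmt (t * U⁻¹)⁻¹ (t * t * U⁻¹)) (t * U⁻¹)⁻¹) (t * t * U⁻¹ * (t * U⁻¹)⁻¹) =
      t⁻¹ * cmt (U * (U⁻¹ * (t * U * t⁻¹)) * U⁻¹ * (t * (U⁻¹ * (t * U * t⁻¹)) * t⁻¹)⁻¹) t * t := by
  simp only [cmt]
  group

theorem cmt_eq_one_iff {G : Type*} [Group G] (a b : G) : cmt a b = 1 ↔ a * b = b * a := by
  rw [cmt, mul_assoc, mul_assoc, inv_mul_eq_one, eq_inv_mul_iff_mul_eq, eq_comm]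

/-- The group of the virtual trefoil in its one-relator presentation. -/
abbrev TrefoilGroup : Type := PresentedGroup {trefoilRelator}

/-- The mapping torus `⟨U, d, c⟩ ⋊ ⟨t⟩` of the monodromy. -/
abbrev MappingTorus : Type := FreeGroup (Fin 3) ⋊[monodromyAction] Multiplicative ℤ

namespace MappingTorus

/-- The generator `t`. -/
def t : MappingTorus := SemidirectProduct.inr (Multiplicative.ofAdd 1)

/-- The inclusion of the fibre. -/
def incl : FreeGroup (Fin 3) →* MappingTorus := SemidirectProduct.inl

theorem conj_t (f : FreeGroup (Fin 3)) : t * incl f * t⁻¹ = incl (monodromyHom f) := by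
  rw [← monodromy_apply, t, ← map_inv]
  refine (SemidirectProduct.inl_aut _ _).symm.trans ?_
  simp [monodromyAction_apply, incl]

end MappingTorus

namespace TrefoilGroup

open MappingTorus in
/-- The homomorphism to the mapping torus: `x ↦ t U⁻¹`, `y ↦ t² U⁻¹`. -/
def toMappingTorus : TrefoilGroup →* MappingTorus :=
  PresentedGroup.toGroup (f := ![t * (incl (FreeGroup.of 0))⁻¹, t * t * (incl (FreeGroup.of 0))⁻¹])
    (by
      rintro r rfl
      have e : ∀ a b : MappingTorus, FreeGroup.lift ![a, b] trefoilRelator =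
          cmt (cmt (cmt a⁻¹ b) a⁻¹) (b * a⁻¹) := by
        intro a b
        simp [trefoilRelator, cmt]
      rw [e, cmt_trefoil]
      have hd : (incl (FreeGroup.of 0))⁻¹ * (t * incl (FreeGroup.of 0) * t⁻¹) =
          incl (FreeGroup.of 1) := by
        rw [conj_t, ← map_inv, ← map_mul]
        simp [monodromyHom]
      have hc : incl (FreeGroup.of 0) * incl (FreeGroup.of 1) * (incl (FreeGroup.of 0))⁻¹ *
          (t * incl (FreeGroup.of 1) * t⁻¹)⁻¹ = incl (FreeGroup.of 2) := by
        rw [conj_t]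
        simp only [← map_inv, ← map_mul]
        simp [monodromyHom, mul_assoc]
      have ht : t * incl (FreeGroup.of 2) * t⁻¹ = incl (FreeGroup.of 2) := by
        rw [conj_t]
        simp [monodromyHom]
      rw [hd, hc, (cmt_eq_one_iff _ _).2 (mul_inv_eq_iff_eq_mul.1 ht).symm]
      simp)

/-- The element `t = y x⁻¹`. -/
def t : TrefoilGroup := PresentedGroup.of 1 * (PresentedGroup.of 0)⁻¹

/-- The element `U = x⁻¹ y x⁻¹`. -/
def U : TrefoilGroup :=
  (PresentedGroup.of 0)⁻¹ * PresentedGroup.of 1 * (PresentedGroup.of 0)⁻¹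

/-- The element `d = U⁻¹ (t U t⁻¹)`. -/
def d : TrefoilGroup := U⁻¹ * (t * U * t⁻¹)

/-- The element `c = U d U⁻¹ (t d t⁻¹)⁻¹`. -/
def c : TrefoilGroup := U * d * U⁻¹ * (t * d * t⁻¹)⁻¹

theorem of_zero : (PresentedGroup.of 0 : TrefoilGroup) = t * U⁻¹ := by
  simp [t, U]

theorem of_one : (PresentedGroup.of 1 : TrefoilGroup) = t * t * U⁻¹ := by
  simp [t, U, mul_assoc]

theorem relator_eq_one : cmt (cmt (cmt (PresentedGroup.of 0 : TrefoilGroup)⁻¹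
    (PresentedGroup.of 1)) (PresentedGroup.of 0)⁻¹)
    (PresentedGroup.of 1 * (PresentedGroup.of 0)⁻¹) = 1 :=
  PresentedGroup.one_of_mem (rels := {trefoilRelator}) rfl

/-- The defining relation, in the generators `t` and `U`. -/
theorem c_mul_t : c * t = t * c := by
  have h := relator_eq_one
  rw [of_zero, of_one, cmt_trefoil, mul_assoc, inv_mul_eq_one, eq_comm, mul_eq_right] at h
  exact (cmt_eq_one_iff _ _).1 h

/-- The homomorphism from the fibre `⟨U, d, c⟩`, sending each generator to its namesake. -/
def fromFibre : FreeGroup (Fin 3) →* TrefoilGroup := FreeGroup.lift ![U, d, c]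

theorem fromFibre_monodromy (f : FreeGroup (Fin 3)) :
    fromFibre (monodromy f) = t * fromFibre f * t⁻¹ := by
  have h : fromFibre.comp monodromyHom = (MulAut.conj t).toMonoidHom.comp fromFibre := by
    apply FreeGroup.ext_hom
    intro i
    fin_cases i
    · simp [fromFibre, monodromyHom, d]
    · simp [fromFibre, monodromyHom, c, mul_assoc]
    · simp [fromFibre, monodromyHom, ← c_mul_t]
  exact DFunLike.congr_fun h f

theorem fromFibre_monodromy_zpow (n : ℤ) (f : FreeGroup (Fin 3)) :
    fromFibre ((monodromy ^ n) f) = t ^ n * fromFibre f * (t ^ n)⁻¹ := by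
  induction n generalizing f with
  | zero => simp
  | succ n ih =>
    rw [zpow_add_one, MulAut.mul_apply, ih, fromFibre_monodromy, zpow_add_one]
    group
  | pred n ih =>
    have h := fromFibre_monodromy (monodromy⁻¹ f)
    rw [MulAut.apply_inv_self] at h
    rw [zpow_sub_one, MulAut.mul_apply, ih, h, zpow_sub_one]
    group

/-- The homomorphism from the mapping torus, a left inverse of `toMappingTorus`. -/
def fromMappingTorus : MappingTorus →* TrefoilGroup :=
  SemidirectProduct.lift fromFibre (zpowersHom _ t) (by
    intro a
    ext f
    simp [monodromyAction_apply, fromFibre_monodromy_zpow, -map_zpow])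

theorem fromMappingTorus_toMappingTorus (g : TrefoilGroup) :
    fromMappingTorus (toMappingTorus g) = g := by
  have h : fromMappingTorus.comp toMappingTorus = MonoidHom.id TrefoilGroup := by
    apply PresentedGroup.ext
    have ht : fromMappingTorus MappingTorus.t = t := by
      simp [fromMappingTorus, MappingTorus.t]
    have hU : fromMappingTorus (MappingTorus.incl (FreeGroup.of 0)) = U := by
      simp [fromMappingTorus, MappingTorus.incl, fromFibre]
    intro i
    fin_cases i
    · refine (congrArg fromMappingTorus (PresentedGroup.toGroup.of _)).trans ?_
      simp [ht, hU, of_zero]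
    · refine (congrArg fromMappingTorus (PresentedGroup.toGroup.of _)).trans ?_
      simp [ht, hU, of_one]
  exact DFunLike.congr_fun h g

end TrefoilGroup

/-! ### The group of the closure of the braid -/

namespace VirtualTrefoil

open PhiA

/-- As automorphisms act on the right, `σ⁻²ρ` substitutes the images under `ρ` into the words
`σ⁻²(x_j)`. -/
theorem phiA_apply (f : FreeGroup (FGen 2)) :
    (phiA 2 virtualTrefoil).unop f = rhoHom 0 (sigmaInvHom 0 (sigmaInvHom 0 f)) := by
  have hs : phiA 2 (VB.σ 0) = MulOpposite.op (sigmaAut 0) := PresentedGroup.toGroup.of _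
  have hr : phiA 2 (VB.ρ 0) = MulOpposite.op (rhoAut 0) := PresentedGroup.toGroup.of _
  simp only [virtualTrefoil, map_mul, map_inv, hs, hr, pow_two, MulOpposite.unop_mul,
    MulOpposite.unop_inv, MulOpposite.unop_op]
  rfl

theorem phiA_y : (phiA 2 virtualTrefoil).unop (FreeGroup.of FGen.y) = Y := by
  have e : (FreeGroup.of FGen.y : FreeGroup (FGen 2)) = Y := rfl
  rw [phiA_apply, e, sigmaInvHom_Y, sigmaInvHom_Y, rhoHom_Y]

theorem phiA_x_zero : (phiA 2 virtualTrefoil).unop (FreeGroup.of (FGen.x 0)) =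
    Y⁻¹ * (X 0)⁻¹ * Y * Y * X 1 * Y⁻¹ * Y⁻¹ * X 0 * Y := by
  have e : (FreeGroup.of (FGen.x 0) : FreeGroup (FGen 2)) = X (VB.lo 0) := rfl
  rw [phiA_apply, e]
  simp only [sigmaInvHom_lo, sigmaInvHom_hi, rhoHom_lo, rhoHom_hi, map_mul, map_inv]
  have h0 : (VB.lo 0 : Fin 2) = 0 := rfl
  have h1 : (VB.hi 0 : Fin 2) = 1 := rfl
  rw [h0, h1]
  group

theorem phiA_x_one : (phiA 2 virtualTrefoil).unop (FreeGroup.of (FGen.x 1)) =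
    Y⁻¹ * (X 0)⁻¹ * Y * (Y * X 1 * Y⁻¹)⁻¹ * (Y⁻¹ * X 0 * Y) * (Y * X 1 * Y⁻¹) * (Y⁻¹ * X 0 * Y) := by
  have e : (FreeGroup.of (FGen.x 1) : FreeGroup (FGen 2)) = X (VB.hi 0) := rfl
  rw [phiA_apply, e]
  simp only [sigmaInvHom_lo, sigmaInvHom_hi, rhoHom_lo, rhoHom_hi, map_mul, map_inv]
  have h0 : (VB.lo 0 : Fin 2) = 0 := rfl
  have h1 : (VB.hi 0 : Fin 2) = 1 := rfl
  rw [h0, h1]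
  simp [mul_assoc]

/-- The two nontrivial relations of `G_A` (with `a = x_0`, `b = x_1`) are equivalent to the trefoil
relation together with an equation that expresses `x_1` by the other generators. -/
theorem relations_iff {G : Type*} [Group G] (a b y : G) :
    (a = y⁻¹ * a⁻¹ * y * y * b * y⁻¹ * y⁻¹ * a * y ∧
      b = y⁻¹ * a⁻¹ * y * (y * b * y⁻¹)⁻¹ * (y⁻¹ * a * y) * (y * b * y⁻¹) * (y⁻¹ * a * y)) ↔
    (b = a⁻¹ * y⁻¹ * a * y * a ∧ cmt (cmt (cmt a⁻¹ y) a⁻¹) (y * a⁻¹) = 1) := by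
  have e : ∀ h : b = a⁻¹ * y⁻¹ * a * y * a,
      (a = y⁻¹ * a⁻¹ * y * y * b * y⁻¹ * y⁻¹ * a * y ↔
        cmt (cmt (cmt a⁻¹ y) a⁻¹) (y * a⁻¹) = 1) := by
    rintro rfl
    obtain ⟨p, hp⟩ : ∃ p, p = y⁻¹ * (y * a * y⁻¹ * a * (y * a⁻¹ * y⁻¹)) * a⁻¹ *
      (y * a * y⁻¹ * (y⁻¹ * a * y)) := ⟨_, rfl⟩
    have h : cmt (cmt (cmt a⁻¹ y) a⁻¹) (y * a⁻¹) = p * (a *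
        (y⁻¹ * a⁻¹ * y * y * (a⁻¹ * y⁻¹ * a * y * a) * y⁻¹ * y⁻¹ * a * y)⁻¹) * p⁻¹ := by
      rw [hp]
      simp only [cmt]
      group
    rw [h, conj_eq_one_iff, mul_inv_eq_one]
  have e2 : ∀ h : a = y⁻¹ * a⁻¹ * y * y * b * y⁻¹ * y⁻¹ * a * y,
      (b = y⁻¹ * a⁻¹ * y * (y * b * y⁻¹)⁻¹ * (y⁻¹ * a * y) * (y * b * y⁻¹) * (y⁻¹ * a * y) ↔
        b = a⁻¹ * y⁻¹ * a * y * a) := by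
    intro h
    have h' : y⁻¹ * a⁻¹ * y * (y * b * y⁻¹)⁻¹ * (y⁻¹ * a * y) =
        (y⁻¹ * a⁻¹ * y * y * b * y⁻¹ * y⁻¹ * a * y)⁻¹ := by simp [mul_assoc]
    have h2 : y * b * y⁻¹ = y⁻¹ * a * y * a * (y⁻¹ * a * y)⁻¹ := by
      nth_rewrite 2 [h]; group
    rw [h', ← h, h2]
    constructor <;> intro h3 <;> rw [h3] <;> group
  constructor
  · rintro ⟨h1, h2⟩
    have h3 := (e2 h1).1 h2
    exact ⟨h3, (e h3).1 h1⟩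
  · rintro ⟨h1, h2⟩
    have h3 := (e h1).2 h2
    exact ⟨h3, (e2 h3).2 h1⟩

theorem closureIsKnot : VB.ClosureIsKnot virtualTrefoil := by
  refine ⟨by norm_num, ?_⟩
  have hs : VB.perm 2 (VB.σ 0) = MulOpposite.op (Equiv.swap 0 1) := PresentedGroup.toGroup.of _
  have hr : VB.perm 2 (VB.ρ 0) = MulOpposite.op (Equiv.swap 0 1) := PresentedGroup.toGroup.of _
  have e : (VB.perm 2 virtualTrefoil).unop = Equiv.swap 0 1 := by
    simp [virtualTrefoil, hs, hr, pow_two]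
  rw [e]
  decide

/-- The isomorphism eliminates the generator `x_1`. -/
theorem nonempty_mulEquiv : Nonempty (GA virtualTrefoil ≃* TrefoilGroup) := by
  let a : TrefoilGroup := PresentedGroup.of 0
  let y : TrefoilGroup := PresentedGroup.of 1
  let b : TrefoilGroup := a⁻¹ * y⁻¹ * a * y * a
  obtain ⟨r0, r1⟩ := (relations_iff a b y).2 ⟨rfl, TrefoilGroup.relator_eq_one⟩
  let f : FGen 2 → TrefoilGroup
    | .x j => if j = 0 then a else b
    | .y => y
  have fX0 : FreeGroup.lift f (X 0) = a := by simp [f, X]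
  have fX1 : FreeGroup.lift f (X 1) = b := by simp [f, X]
  have fY : FreeGroup.lift f Y = y := by simp [f, Y]
  have hf : ∀ r ∈ {w : FreeGroup (FGen 2) | ∃ h : FGen 2,
      w = FreeGroup.of h * ((phiA 2 virtualTrefoil).unop (FreeGroup.of h))⁻¹},
      FreeGroup.lift f r = 1 := by
    rintro r ⟨h, rfl⟩
    rw [map_mul, map_inv, mul_inv_eq_one]
    rcases h with j | _
    · fin_cases j
      · simp only [Fin.zero_eta, phiA_x_zero, map_mul, map_inv, fX0, fX1, fY]
        exact fX0.trans r0
      · simp only [Fin.mk_one, phiA_x_one, map_mul, map_inv, fX0, fX1, fY]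
        exact fX1.trans r1
    · rw [phiA_y]; rfl
  let A : GA virtualTrefoil := PresentedGroup.of (FGen.x 0)
  let B : GA virtualTrefoil := PresentedGroup.of (FGen.x 1)
  let C : GA virtualTrefoil := PresentedGroup.of FGen.y
  have rel : ∀ h : FGen 2, (PresentedGroup.of h : GA virtualTrefoil) =
      PresentedGroup.mk _ ((phiA 2 virtualTrefoil).unop (FreeGroup.of h)) := by
    intro h
    have := PresentedGroup.one_of_mem (rels := {w : FreeGroup (FGen 2) | ∃ h : FGen 2,
      w = FreeGroup.of h * ((phiA 2 virtualTrefoil).unop (FreeGroup.of h))⁻¹}) ⟨h, rfl⟩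
    rwa [map_mul, map_inv, mul_inv_eq_one] at this
  have s0 := rel (FGen.x 0)
  have s1 := rel (FGen.x 1)
  rw [phiA_x_zero] at s0
  rw [phiA_x_one] at s1
  simp only [map_mul, map_inv] at s0 s1
  obtain ⟨hB, hrel⟩ := (relations_iff A B C).1 ⟨s0, s1⟩
  have hg : ∀ r ∈ ({trefoilRelator} : Set (FreeGroup (Fin 2))), FreeGroup.lift ![A, C] r = 1 := by
    rintro r rfl
    rw [← hrel]
    simp [trefoilRelator, cmt]
  refine ⟨MonoidHom.toMulEquiv (PresentedGroup.toGroup hf) (PresentedGroup.toGroup hg) ?_ ?_⟩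
  · apply PresentedGroup.ext
    rintro (j | _)
    · fin_cases j
      · simp [f, a, A]
      · simp [f, a, b, y]
        exact hB.symm
    · simp [f, y, C]
  · apply PresentedGroup.ext
    intro i
    fin_cases i
    · simp [A, f, a]
    · simp [C, f, y]

end VirtualTrefoil

/-- Residual nilpotence is inherited from the mapping torus, in which the group embeds. -/
theorem exists_nilpotent_trefoilGroup (g : TrefoilGroup) (hg : g ≠ 1) :
    ∃ (N : Type) (_ : Group N) (ψ : TrefoilGroup →* N), Group.IsNilpotent N ∧ ψ g ≠ 1 := by
  have hg' : TrefoilGroup.toMappingTorus g ≠ 1 := by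
    intro h
    apply hg
    rw [← TrefoilGroup.fromMappingTorus_toMappingTorus g, h, map_one]
  obtain ⟨N, _, ψ, hN, hψ⟩ := exists_nilpotent_of_trivialOnGraded monodromyAction
    (w := fun i : Fin 3 => (i : ℕ) + 1) (fun i => by simp)
    (fun a => (WeightedSeries.trivialOnGraded _).zpow_mem monodromy_mem_trivialOnGraded a.toAdd)
    _ hg'
  exact ⟨N, _, ψ.comp TrefoilGroup.toMappingTorus, hN, hψ⟩

theorem mainTheorem2 :
    VB.ClosureIsKnot virtualTrefoil ∧
    Nonempty (GA virtualTrefoil ≃* PresentedGroup {trefoilRelator}) ∧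
    IsResiduallyNilpotent (GA virtualTrefoil) := by
  obtain ⟨e⟩ := VirtualTrefoil.nonempty_mulEquiv
  refine ⟨VirtualTrefoil.closureIsKnot, ⟨e⟩, ?_, fun g hg => ?_⟩
  · -- `x ↦ t U⁻¹` has nontrivial image in the infinite cyclic quotient of the mapping torus
    let q := (SemidirectProduct.rightHom.comp TrefoilGroup.toMappingTorus).comp e.toMonoidHom
    refine ⟨⟨e.symm (PresentedGroup.of 0), 1, fun h => ?_⟩⟩
    have h1 := congrArg q h
    simp [q, TrefoilGroup.toMappingTorus, MappingTorus.t, MappingTorus.incl] at h1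
  · obtain ⟨N, _, ψ, hN, hψ⟩ := exists_nilpotent_trefoilGroup (e g) (by simpa using hg)
    exact ⟨N, _, ψ.comp e.toMonoidHom, hN, hψ⟩
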